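/- Let $\mathbb K$ be an algebraically closed field of characteristic zero, let $n\ge 2$, and let $W_n$ be the Lie algebra of all $\mathbb K$-derivations of $\mathbb K[x_1,\dots,x_n]$, with its standard grading $W_n=\bigoplus_{i\ge -1}W_n^{[i]}$, where $W_n^{[i]}$ consists of the derivations $\sum_{k=1}^n f_k\,\partial/\partial x_k$ in which every $f_k$ is zero or homogeneous of degree $i+1$. For $i\ge 0$ let $M_i$ be the set of all $D=\sum_k f_k\,\partial/\partial x_k\in W_n^{[i]}$ with zero divergence $\sum_k \partial f_k/\partial x_k=0$, and let $N_i$ be the set of all $D\in W_n^{[i]}$ of the form $D=fE_n$ with $f\in\mathbb K[x_1,\dots,x_n]$, where $E_n=\sum_{k=1}^n x_k\,\partial/\partial x_k$ is the Euler derivation. For subspaces $S,T\subseteq W_n$ let $[S,T]$ denote the linear span of all $[s,t]$ with $s\in S$, $t\in T$. Then: 1. The spaces $W_n^{[i]}$ ($i\ge -1$), $N_i$ and $M_i$ ($i\ge 0$) are finite-dimensional, with $$\dim W_n^{[i]}=n\binom{n+i}{i+1},\qquad \dim N_i=\binom{n+i-1}{i},\qquad \dim M_i=\frac{(n+i+1)\,(n+i-1)!}{(i+1)!\,(n-2)!}.$$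 2. If $S,T$ are submodules of $W_n$, regarded as a module over the Lie subalgebra $W_n^{[0]}$ via the bracket, then $[S,T]$ is also a $W_n^{[0]}$-submodule of $W_n$. 3. $[M_i,M_j]=M_{i+j}$ for all $i,j\ge 0$. 4. $[N_i,N_j]=N_{i+j}$ for all $i,j\ge 0$ with $i\ne j$, and $[N_i,N_i]=0$ for all $i\ge 0$. 5. $[M_i,N_j]=W_n^{[i+j]}$ for all $i,j\ge 1$, while in the remaining cases (a) $[M_0,N_0]=0$; (b) $[M_0,N_j]=N_j$ for all $j\ge 1$; (c) $[M_i,N_0]=M_i$ for all $i\ge 1$. 6. $[W_n^{[-1]},N_j]=W_n^{[j-1]}$ for all $j\ge 0$. -/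

import Mathlib

namespace PolyVF

open MvPolynomial

/-- The Lie algebra `W_n(K)` of all `K`-derivations of `K[x_1, ..., x_n]`, with the commutator
bracket. -/
abbrev W (K : Type*) [Field K] (n : ℕ) : Type _ :=
  Derivation K (MvPolynomial (Fin n) K) (MvPolynomial (Fin n) K)

/-- The component `W_n^{[i]}` of the standard grading (`i : ℤ`): all derivations
`D = ∑ f_j ∂/∂x_j` whose coefficients `f_j = D x_j` are zero or homogeneous of degree `i + 1`.
(Each variable has weight `1 : ℤ`; the component vanishes for `i < -1`, see
`mem_comp_natCast_sub_one` for the case `i ≥ -1`.) -/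
def comp (K : Type*) [Field K] (n : ℕ) (i : ℤ) : Submodule K (W K n) where
  carrier := {D | ∀ j, IsWeightedHomogeneous (fun _ : Fin n => (1 : ℤ)) (D (X j)) (i + 1)}
  zero_mem' := fun _ => isWeightedHomogeneous_zero _ _ _
  add_mem' := fun ha hb j => (ha j).add (hb j)
  smul_mem' := fun c _ h j => (weightedHomogeneousSubmodule K _ _).smul_mem c (h j)

/-- In terms of the usual degree: the coefficients are homogeneous of degree `d` in `W_n^{[d-1]}`. -/
theorem mem_comp_natCast_sub_one {K : Type*} [Field K] {n : ℕ} {d : ℕ} {D : W K n} :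
    D ∈ comp K n ((d : ℤ) - 1) ↔ ∀ j, (D (X j)).IsHomogeneous d := by
  have key : ∀ m : Fin n →₀ ℕ,
      Finsupp.weight (fun _ : Fin n => (1 : ℤ)) m = (Finsupp.weight (1 : Fin n → ℕ) m : ℕ) := by
    intro m
    simp [Finsupp.weight_apply, Finsupp.sum]
  change (∀ j, IsWeightedHomogeneous (fun _ : Fin n => (1 : ℤ)) (D (X j)) ((d : ℤ) - 1 + 1)) ↔ _
  simp only [IsHomogeneous, IsWeightedHomogeneous, key, sub_add_cancel, Nat.cast_inj]

theorem lie_mem_comp {K : Type*} [Field K] {n : ℕ} {i j : ℤ} {D E : W K n}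
    (hD : D ∈ comp K n i) (hE : E ∈ comp K n j) : ⁅D, E⁆ ∈ comp K n (i + j) := by
  have main : ∀ {a b : ℤ} {F : W K n} {f : MvPolynomial (Fin n) K}, F ∈ comp K n a →
      IsWeightedHomogeneous (fun _ : Fin n => (1 : ℤ)) f (b + 1) →
      IsWeightedHomogeneous (fun _ : Fin n => (1 : ℤ)) (F f) (a + b + 1) := by
    intro a b F f hF hf
    have hsum : ∀ (G : Fin n → W K n) (g : MvPolynomial (Fin n) K),
        (∑ k, G k) g = ∑ k, G k g := fun G g =>
      map_sum (⟨⟨fun D : W K n => D g, rfl⟩, fun _ _ => rfl⟩ : W K n →+ _) G _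
    have h : F f = ∑ k, pderiv k f * F (X k) := by
      have : F = ∑ k, F (X k) • pderiv k := by
        apply derivation_ext
        intro k
        rw [hsum]
        simp [pderiv_X, Pi.single_apply]
      conv_lhs => rw [this]
      rw [hsum]
      simp [mul_comm]
    rw [h]
    refine IsWeightedHomogeneous.sum _ _ _ fun k _ => ?_
    have := (hf.pderiv (i := k) (n' := b) rfl).mul (hF k)
    rwa [show b + (a + 1) = a + b + 1 by ring] at this
  intro k
  rw [Derivation.commutator_apply]
  refine (weightedHomogeneousSubmodule K _ _).sub_mem (main hD (hE k)) ?_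
  have := main hE (hD k)
  rwa [add_comm j i] at this

/-- The Lie subalgebra `W_n^{[0]}` of linear derivations; it acts on `W_n` by the bracket. -/
def linearPart (K : Type*) [Field K] (n : ℕ) : LieSubalgebra K (W K n) where
  __ := comp K n 0
  lie_mem' := fun {_ _} hD hE => lie_mem_comp (i := 0) (j := 0) hD hE

/-- The Euler derivation `E_n = ∑ x_i ∂/∂x_i`. -/
noncomputable def euler (K : Type*) [Field K] (n : ℕ) : W K n :=
  ∑ i, (X i : MvPolynomial (Fin n) K) • pderiv i

/-- The divergence `div D = ∑ ∂f_i/∂x_i` of `D = ∑ f_i ∂/∂x_i`. -/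
noncomputable def divergence (K : Type*) [Field K] (n : ℕ) :
    W K n →ₗ[K] MvPolynomial (Fin n) K where
  toFun D := ∑ i, pderiv i (D (X i))
  map_add' D E := by simp [Finset.sum_add_distrib]
  map_smul' c D := by simp [Finset.smul_sum]

/-- `M_i`: the divergence-free derivations in `W_n^{[i]}`. -/
noncomputable def M (K : Type*) [Field K] (n : ℕ) (i : ℕ) : Submodule K (W K n) :=
  comp K n i ⊓ LinearMap.ker (divergence K n)

/-- `N_i`: the derivations in `W_n^{[i]}` of the form `f E_n` with `f` a polynomial. -/
noncomputable def N (K : Type*) [Field K] (n : ℕ) (i : ℕ) : Submodule K (W K n) :=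
  comp K n i ⊓
    (Submodule.span (MvPolynomial (Fin n) K) {euler K n}).restrictScalars K

/-- `[S, T]`: the `K`-linear span of all brackets `[s, t]` with `s ∈ S`, `t ∈ T`. -/
noncomputable def brackets {K : Type*} [Field K] {n : ℕ} (S T : Submodule K (W K n)) :
    Submodule K (W K n) :=
  Submodule.span K {D | ∃ s ∈ S, ∃ t ∈ T, ⁅s, t⁆ = D}

end PolyVF

namespace PolyVF

open MvPolynomial

/-! ### Derivations in coordinates: Euler field, divergence, generators of homogeneous pieces -/

section Basic

variable {K : Type*} [Field K] {n : ℕ}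

/-! Write `E` for the Euler field. It multiplies homogeneous polynomials of degree `d` by `d`, so
`div (f E) = (n + d) f` for such `f`, and `[D, f E] = D(f) E - i f D` for `D` of degree `i`
(`lie_smul_euler`). Subtracting a multiple of `(div D) E` therefore splits `W_n^{[i]}` as `M_i ⊕
N_i` (`comp_eq_sup`, `M_inf_N`), and the dimension of `M_i` follows by counting monomials.

For the bracket identities, upper bounds are degree and divergence computations; lower bounds need
good generators. A divergence-free field is a combination of fields `ham k l h`, by an explicit
Poincaré-type formula (`sum_sum_ham`). For fixed `k, l` these bracket like Hamiltonian fields in two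
variables (`lie_ham`), which reduces `[M_i, M_j]` to one identity between Poisson brackets of
monomials.

The brackets `[M_i, N_j]` are stable under the operators `ad (x_k ∂/∂x_l)`, `k ≠ l`. In
characteristic zero these operators produce all of `N_i` from one pure power `x_l ^ i E`
(`N_le_of_stable`), and all of `M_i` from the fields `x^m ∂/∂x_k` with `x^m` free of `x_k`
(`M_le_of_stable`). Both seeds come out of the formula for `[D, f E]`: take `D f = 0` for the
second, `D f` a pure power for the first. -/

theorem sum_apply {ι : Type*} (s : Finset ι) (G : ι → W K n) (g : MvPolynomial (Fin n) K) :
    (∑ k ∈ s, G k) g = ∑ k ∈ s, G k g :=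
  map_sum (⟨⟨fun D : W K n => D g, rfl⟩, fun _ _ => rfl⟩ : W K n →+ _) G s

theorem eq_sum_smul_pderiv (D : W K n) : D = ∑ k, D (X k) • pderiv k := by
  apply derivation_ext
  intro k
  simp [sum_apply, pderiv_X, Pi.single_apply]

theorem apply_eq_sum (D : W K n) (f : MvPolynomial (Fin n) K) :
    D f = ∑ k, D (X k) * pderiv k f := by
  conv_lhs => rw [eq_sum_smul_pderiv D]
  simp [sum_apply]

@[simp]
theorem pderiv_pderiv_X (k l i : Fin n) :
    pderiv k (pderiv l (X i : MvPolynomial (Fin n) K)) = 0 := by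
  by_cases h : i = l
  · subst h
    simp
  · simp [pderiv_X_of_ne h]

theorem pderiv_comm (k l : Fin n) (f : MvPolynomial (Fin n) K) :
    pderiv k (pderiv l f) = pderiv l (pderiv k f) := by
  have h : ⁅(pderiv k : W K n), (pderiv l : W K n)⁆ = 0 := by
    apply derivation_ext
    intro i
    simp [Derivation.commutator_apply, -pderiv_X]
  have h' := congrArg (fun D : W K n => D f) h
  simpa [Derivation.commutator_apply, sub_eq_zero] using h'

@[simp]
theorem euler_X (k : Fin n) : euler K n (X k) = X k := by
  simp [euler, sum_apply, pderiv_X, Pi.single_apply]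

theorem euler_apply_of_isHomogeneous {d : ℕ} {f : MvPolynomial (Fin n) K}
    (hf : f.IsHomogeneous d) : euler K n f = (d : K) • f := by
  rw [apply_eq_sum]
  simp [hf.sum_X_mul_pderiv, Nat.cast_smul_eq_nsmul]

theorem lie_smul_right (D E : W K n) (f : MvPolynomial (Fin n) K) :
    ⁅D, f • E⁆ = D f • E + f • ⁅D, E⁆ := by
  ext i
  simp only [Derivation.commutator_apply, Derivation.add_apply, Derivation.smul_apply,
    smul_eq_mul, Derivation.leibniz]
  congr 1
  ring

/-- The scalar is the difference of the eigenvalues of `E` on `g` and `f`; its vanishing at `i = j`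
is the whole exception in `[N_i, N_j]`. -/
theorem lie_smul_smul_euler {i j : ℕ} {f g : MvPolynomial (Fin n) K}
    (hf : f.IsHomogeneous i) (hg : g.IsHomogeneous j) :
    ⁅f • euler K n, g • euler K n⁆ = ((j : K) - i) • (f * g) • euler K n := by
  apply derivation_ext
  intro k
  simp only [Derivation.commutator_apply, Derivation.smul_apply, euler_X, Derivation.leibniz,
    euler_apply_of_isHomogeneous hf, euler_apply_of_isHomogeneous hg, smul_eq_mul, sub_smul,
    mul_smul_comm]
  simp only [MvPolynomial.smul_eq_C_mul]
  ring

theorem mem_comp_natCast {i : ℕ} {D : W K n} :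
    D ∈ comp K n i ↔ ∀ j, (D (X j)).IsHomogeneous (i + 1) := by
  rw [← mem_comp_natCast_sub_one]
  simp

theorem lie_euler_of_mem_comp {i : ℕ} {D : W K n} (hD : D ∈ comp K n i) :
    ⁅D, euler K n⁆ = -((i : K) • D) := by
  apply derivation_ext
  intro k
  simp only [Derivation.commutator_apply, euler_X, Derivation.neg_apply, Derivation.smul_apply,
    euler_apply_of_isHomogeneous (mem_comp_natCast.1 hD k)]
  push_cast
  simp [add_smul]

theorem isHomogeneous_apply {i d : ℕ} {D : W K n} (hD : D ∈ comp K n i)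
    {f : MvPolynomial (Fin n) K} (hf : f.IsHomogeneous d) : (D f).IsHomogeneous (i + d) := by
  rw [apply_eq_sum]
  refine IsHomogeneous.sum _ _ _ fun k _ => ?_
  -- Constants are treated apart because the degree `d - 1` of a derivative is truncated at `d = 0`;
  -- there the derivative is zero.
  obtain _ | d := d
  · rw [← totalDegree_zero_iff_isHomogeneous, totalDegree_eq_zero_iff_eq_C] at hf
    rw [hf, pderiv_C, mul_zero]
    exact isHomogeneous_zero _ _ _
  · have := (mem_comp_natCast.1 hD k).mul (hf.pderiv (i := k))
    rwa [show i + 1 + (d + 1 - 1) = i + (d + 1) by omega] at this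

theorem smul_mem_comp {i d : ℕ} {D : W K n} (hD : D ∈ comp K n i)
    {f : MvPolynomial (Fin n) K} (hf : f.IsHomogeneous d) : f • D ∈ comp K n (d + i : ℕ) := by
  rw [mem_comp_natCast]
  intro j
  simpa [add_assoc] using hf.mul (mem_comp_natCast.1 hD j)

theorem smul_pderiv_mem_comp {i : ℕ} {f : MvPolynomial (Fin n) K} (hf : f.IsHomogeneous (i + 1))
    (k : Fin n) : f • (pderiv k : W K n) ∈ comp K n i := by
  rw [mem_comp_natCast]
  intro j
  by_cases h : j = k
  · subst h
    simpa
  · simpa [pderiv_X_of_ne h] using isHomogeneous_zero _ _ _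

theorem euler_mem_comp : euler K n ∈ comp K n (0 : ℕ) := by
  rw [mem_comp_natCast]
  simp [isHomogeneous_X]

theorem lie_mem_comp_nat {i j : ℕ} {D E : W K n} (hD : D ∈ comp K n i) (hE : E ∈ comp K n j) :
    ⁅D, E⁆ ∈ comp K n (i + j : ℕ) := by
  push_cast
  exact lie_mem_comp hD hE

theorem isHomogeneous_of_mul_X {d : ℕ} {f : MvPolynomial (Fin n) K} {k : Fin n}
    (h : (f * X k).IsHomogeneous (d + 1)) : f.IsHomogeneous d := by
  intro m hm
  have := @h (m + Finsupp.single k 1) (by rwa [coeff_mul_X])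
  rw [map_add, Finsupp.weight_single] at this
  simpa using this

theorem mem_N {i : ℕ} [NeZero n] {D : W K n} :
    D ∈ N K n i ↔ ∃ f : MvPolynomial (Fin n) K, f.IsHomogeneous i ∧ D = f • euler K n := by
  constructor
  · rintro ⟨h1, h2⟩
    obtain ⟨f, rfl⟩ := Submodule.mem_span_singleton.1 h2
    refine ⟨f, isHomogeneous_of_mul_X (k := 0) ?_, rfl⟩
    simpa using mem_comp_natCast.1 h1 0
  · rintro ⟨f, hf, rfl⟩
    exact ⟨smul_mem_comp euler_mem_comp hf, Submodule.mem_span_singleton.2 ⟨f, rfl⟩⟩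

theorem divergence_apply (D : W K n) : divergence K n D = ∑ i, pderiv i (D (X i)) := rfl

theorem divergence_smul (f : MvPolynomial (Fin n) K) (D : W K n) :
    divergence K n (f • D) = D f + f * divergence K n D := by
  simp only [divergence_apply, Derivation.smul_apply, smul_eq_mul, Derivation.leibniz,
    Finset.sum_add_distrib, ← Finset.mul_sum, apply_eq_sum D f]
  rw [add_comm]

@[simp]
theorem divergence_pderiv (k : Fin n) : divergence K n (pderiv k) = 0 := by
  simp [divergence_apply, -pderiv_X]

@[simp]
theorem divergence_euler : divergence K n (euler K n) = n := by
  simp [divergence_apply]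

theorem divergence_smul_euler {d : ℕ} {f : MvPolynomial (Fin n) K} (hf : f.IsHomogeneous d) :
    divergence K n (f • euler K n) = ((n : K) + d) • f := by
  rw [divergence_smul, divergence_euler, euler_apply_of_isHomogeneous hf]
  simp only [smul_eq_C_mul, map_add, map_natCast]
  ring

theorem isHomogeneous_divergence {i : ℕ} {D : W K n} (hD : D ∈ comp K n i) :
    (divergence K n D).IsHomogeneous i :=
  IsHomogeneous.sum _ _ _ fun k _ => (mem_comp_natCast.1 hD k).pderiv

/-- The only other terms are traces of products of the two Jacobian matrices, and these cancel by
symmetry of the trace. -/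
theorem divergence_lie (D E : W K n) :
    divergence K n ⁅D, E⁆ = D (divergence K n E) - E (divergence K n D) := by
  have key : ∀ (D E : W K n), ∑ i, pderiv i (D (E (X i))) =
      D (divergence K n E) + ∑ i, ∑ j, pderiv i (D (X j)) * pderiv j (E (X i)) := by
    intro D E
    rw [divergence_apply, map_sum, ← Finset.sum_add_distrib]
    refine Finset.sum_congr rfl fun i _ => ?_
    rw [apply_eq_sum D, apply_eq_sum D, map_sum, ← Finset.sum_add_distrib]
    refine Finset.sum_congr rfl fun j _ => ?_
    rw [Derivation.leibniz, pderiv_comm i j]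
    simp only [smul_eq_mul]
    ring
  rw [divergence_apply]
  simp only [Derivation.commutator_apply, map_sub, Finset.sum_sub_distrib]
  rw [key, key, Finset.sum_comm (f := fun i j => pderiv i (E (X j)) * pderiv j (D (X i)))]
  simp only [mul_comm]
  ring

theorem mem_M {i : ℕ} {D : W K n} : D ∈ M K n i ↔ D ∈ comp K n i ∧ divergence K n D = 0 :=
  Iff.rfl

theorem lie_mem_brackets {S T : Submodule K (W K n)} {D E : W K n} (hD : D ∈ S) (hE : E ∈ T) :
    ⁅D, E⁆ ∈ brackets S T :=
  Submodule.subset_span ⟨D, hD, E, hE, rfl⟩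

theorem brackets_le {S T U : Submodule K (W K n)} :
    brackets S T ≤ U ↔ ∀ D ∈ S, ∀ E ∈ T, ⁅D, E⁆ ∈ U := by
  rw [brackets, Submodule.span_le]
  constructor
  · exact fun h D hD E hE => h ⟨D, hD, E, hE, rfl⟩
  · rintro h _ ⟨D, hD, E, hE, rfl⟩
    exact h D hD E hE

/-- By the Jacobi identity, `ad A` is a derivation of the bracket. -/
theorem lie_mem_brackets_of_stable {S T : Submodule K (W K n)} {A : W K n}
    (hS : ∀ D ∈ S, ⁅A, D⁆ ∈ S) (hT : ∀ E ∈ T, ⁅A, E⁆ ∈ T) {D : W K n}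
    (hD : D ∈ brackets S T) : ⁅A, D⁆ ∈ brackets S T := by
  have : brackets S T ≤ (brackets S T).comap (LieAlgebra.ad K (W K n) A : W K n →ₗ[K] W K n) := by
    rw [brackets_le]
    intro D hD E hE
    rw [Submodule.mem_comap, LieAlgebra.ad_apply, leibniz_lie]
    exact add_mem (lie_mem_brackets (hS _ hD) hE) (lie_mem_brackets hD (hT _ hE))
  exact this hD

theorem homogeneousSubmodule_le {d : ℕ} {T : Submodule K (MvPolynomial (Fin n) K)}
    (h : ∀ m : Fin n →₀ ℕ, m.degree = d → monomial m 1 ∈ T) :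
    homogeneousSubmodule (Fin n) K d ≤ T := by
  intro f hf
  rw [f.as_sum]
  refine sum_mem fun m hm => ?_
  rw [← mul_one (coeff m f), ← smul_eq_mul, ← smul_monomial]
  refine T.smul_mem _ (h m ?_)
  by_contra hne
  exact (mem_support_iff.1 hm) (IsHomogeneous.coeff_eq_zero hf hne)

theorem exists_add_of_degree_eq {a b : ℕ} {m : Fin n →₀ ℕ} (h : m.degree = a + b) :
    ∃ u v : Fin n →₀ ℕ, m = u + v ∧ u.degree = a ∧ v.degree = b := by
  induction a generalizing m with
  | zero => exact ⟨0, m, by simp, by simp, by simpa using h⟩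
  | succ a ih =>
    have hm : m ≠ 0 := by
      rintro rfl
      simp at h
      omega
    obtain ⟨k, hk⟩ := Finsupp.ne_iff.1 hm
    have hle : Finsupp.single k 1 ≤ m := by
      simpa [Nat.one_le_iff_ne_zero] using hk
    obtain ⟨m', rfl⟩ := exists_add_of_le hle
    obtain ⟨u, v, rfl, hu, hv⟩ := ih (m := m') (by
      simp at h
      omega)
    exact ⟨Finsupp.single k 1 + u, v, by rw [add_assoc], by simp [hu, add_comm], hv⟩

end Basic

/-! ### Hamiltonian generators of the divergence-free fields, and `[M_i, M_j]` -/

section Hamiltonian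

variable {K : Type*} [Field K] {n : ℕ}

/-- The derivation `∂h/∂x_l ∂/∂x_k - ∂h/∂x_k ∂/∂x_l` attached to a polynomial `h`. -/
noncomputable def ham (k l : Fin n) : MvPolynomial (Fin n) K →ₗ[K] W K n where
  toFun h := pderiv l h • pderiv k - pderiv k h • pderiv l
  map_add' g h := by
    simp only [map_add, add_smul]
    abel
  map_smul' c h := by simp [smul_sub]

theorem ham_def (k l : Fin n) (h : MvPolynomial (Fin n) K) :
    ham k l h = pderiv l h • pderiv k - pderiv k h • pderiv l := rfl

theorem ham_apply (k l : Fin n) (h f : MvPolynomial (Fin n) K) :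
    ham k l h f = pderiv l h * pderiv k f - pderiv k h * pderiv l f := rfl

theorem ham_mem_M (k l : Fin n) {i : ℕ} {h : MvPolynomial (Fin n) K}
    (hh : h.IsHomogeneous (i + 2)) : ham k l h ∈ M K n i := by
  refine mem_M.2 ⟨sub_mem (smul_pderiv_mem_comp hh.pderiv k) (smul_pderiv_mem_comp hh.pderiv l), ?_⟩
  rw [ham_def, map_sub, divergence_smul, divergence_smul, pderiv_comm k l]
  simp

/-- Up to sign, `ham k l g h` is the Poisson bracket of `g` and `h` in the variables `x_k, x_l`;
this is its Jacobi identity. -/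
theorem lie_ham (k l : Fin n) (g h : MvPolynomial (Fin n) K) :
    ⁅ham k l g, ham k l h⁆ = ham k l (ham k l g h) := by
  ext f : 1
  simp only [Derivation.commutator_apply, ham_apply, map_sub, Derivation.leibniz, smul_eq_mul,
    Derivation.sub_apply, pderiv_comm l k]
  ring

/-- Away from characteristic 2 this is `lie_ham` for `g = -x_k ^ 2 / 2`. -/
theorem lie_X_smul_pderiv_ham {k l : Fin n} (hkl : k ≠ l) (h : MvPolynomial (Fin n) K) :
    ⁅(X k : MvPolynomial (Fin n) K) • (pderiv l : W K n), ham k l h⁆ =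
      ham k l (X k * pderiv l h) := by
  ext f : 1
  simp only [Derivation.commutator_apply, ham_apply, map_sub, Derivation.leibniz, smul_eq_mul,
    pderiv_comm l k, Derivation.smul_apply, pderiv_X_self, pderiv_X_of_ne hkl]
  ring

/-- A Poincaré lemma by contraction with `E`. Euler's identity makes the first half of the sum `(n +
i + 1) D`; since `div D = 0`, the second half is just `D`. -/
theorem sum_sum_ham {i : ℕ} {D : W K n} (hD : D ∈ M K n i) :
    ∑ k, ∑ l, ham k l (X l * D (X k)) = ((n : K) + i) • D := by
  obtain ⟨hc, hdiv⟩ := mem_M.1 hD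
  have h1 : ∀ k, ∑ l, pderiv l (X l * D (X k)) = ((n : K) + i + 1) • D (X k) := by
    intro k
    simp only [Derivation.leibniz, smul_eq_mul, Finset.sum_add_distrib, pderiv_X_self, mul_one,
      (mem_comp_natCast.1 hc k).sum_X_mul_pderiv]
    simp only [nsmul_eq_mul, Nat.cast_add, Nat.cast_one, Finset.sum_const, Finset.card_univ,
      Fintype.card_fin, smul_eq_C_mul, map_add, map_natCast, map_one]
    ring
  have h2 : ∀ l, ∑ k, pderiv k (X l * D (X k)) = D (X l) := by
    intro l
    rw [divergence_apply] at hdiv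
    simp [Finset.sum_add_distrib, ← Finset.mul_sum, hdiv, pderiv_X, Pi.single_apply]
  simp only [ham_def, Finset.sum_sub_distrib, ← Finset.sum_smul, h1]
  rw [Finset.sum_comm (f := fun k l => pderiv k (X l * D (X k)) • (pderiv l : W K n))]
  simp only [← Finset.sum_smul, h2]
  rw [← eq_sum_smul_pderiv]
  simp only [smul_assoc, ← Finset.smul_sum]
  rw [← eq_sum_smul_pderiv, add_smul _ (1 : K)]
  simp

theorem ham_self (k : Fin n) (h : MvPolynomial (Fin n) K) : ham k k h = 0 :=
  sub_self _

theorem M_le [CharZero K] [NeZero n] {i : ℕ} {B : Submodule K (W K n)}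
    (hB : ∀ k l : Fin n, k ≠ l → ∀ m : Fin n →₀ ℕ, m.degree = i + 2 →
      ham k l (monomial m 1) ∈ B) : M K n i ≤ B := by
  have h1 : ∀ k l : Fin n, ∀ h : MvPolynomial (Fin n) K, h.IsHomogeneous (i + 2) →
      ham k l h ∈ B := by
    intro k l h hh
    by_cases hkl : k = l
    · subst hkl
      rw [ham_self]
      exact zero_mem _
    · exact homogeneousSubmodule_le (T := B.comap (ham k l)) (hB k l hkl) hh
  intro D hD
  have hne : (n : K) + i ≠ 0 := by
    exact_mod_cast (show n + i ≠ 0 from fun h => NeZero.ne n (by omega))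
  rw [← inv_smul_smul₀ hne D, ← sum_sum_ham hD]
  refine B.smul_mem _ (sum_mem fun k _ => sum_mem fun l _ => h1 k l _ ?_)
  have := (isHomogeneous_X K l).mul (mem_comp_natCast.1 hD.1 k)
  rwa [show 1 + (i + 1) = i + 2 by omega] at this

theorem X_mul_pderiv_monomial_add_single (k l : Fin n) (m : Fin n →₀ ℕ) :
    X k * pderiv l (monomial (m + Finsupp.single l 1) (1 : K)) =
      ((m l : K) + 1) • monomial (m + Finsupp.single k 1) (1 : K) := by
  rw [pderiv_monomial, add_tsub_cancel_right, X, monomial_mul, smul_monomial,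
    add_comm m (Finsupp.single k 1)]
  simp

theorem exists_eq_add_single {k : Fin n} {m : Fin n →₀ ℕ} (h : m k ≠ 0) :
    ∃ m', m = m' + Finsupp.single k 1 := by
  have hle : Finsupp.single k 1 ≤ m := by
    simpa [Nat.one_le_iff_ne_zero] using h
  obtain ⟨m', rfl⟩ := exists_add_of_le hle
  exact ⟨m', add_comm _ _⟩

theorem monomial_eq_smul_X_mul_pderiv [CharZero K] (k l : Fin n) (m : Fin n →₀ ℕ) :
    monomial (m + Finsupp.single k 1) (1 : K) =
      ((m l : K) + 1)⁻¹ • (X k * pderiv l (monomial (m + Finsupp.single l 1) (1 : K))) := by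
  rw [X_mul_pderiv_monomial_add_single, inv_smul_smul₀ (Nat.cast_add_one_ne_zero _)]

/-- A subspace stable under all `x_k ∂/∂x_l` with `k ≠ l` contains `M_i` as soon as it contains
the derivations `x^m ∂/∂x_k` of degree `i` whose coefficient does not involve `x_k`. -/
theorem M_le_of_stable [CharZero K] [NeZero n] {i : ℕ} {B : Submodule K (W K n)}
    (hstable : ∀ k l : Fin n, k ≠ l → ∀ D ∈ B,
      ⁅(X k : MvPolynomial (Fin n) K) • (pderiv l : W K n), D⁆ ∈ B)
    (hB : ∀ k : Fin n, ∀ m : Fin n →₀ ℕ, m k = 0 → m.degree = i + 1 →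
      monomial m (1 : K) • (pderiv k : W K n) ∈ B) : M K n i ≤ B := by
  refine M_le fun k l hkl m hm => ?_
  -- Induction on the exponent of `x_k`. At exponent 0 only the `∂/∂x_k` term survives, with
  -- coefficient free of `x_k`. Otherwise `ad (x_k ∂/∂x_l)` turns one factor `x_l` into `x_k`, up to
  -- a nonzero integer.
  induction ha : m k generalizing m with
  | zero =>
    have h0 : pderiv k (monomial m (1 : K)) = 0 := by simp [pderiv_monomial, ha]
    rw [ham_def, h0, zero_smul, sub_zero]
    by_cases hml : m l = 0
    · simp [pderiv_monomial, hml]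
    · obtain ⟨m, rfl⟩ := exists_eq_add_single hml
      rw [pderiv_monomial, add_tsub_cancel_right, one_mul, ← mul_one ((_ : ℕ) : K), ← smul_eq_mul,
        ← smul_monomial, smul_assoc]
      refine B.smul_mem _ (hB k m ?_ ?_)
      · simpa [hkl] using ha
      · simp at hm
        omega
  | succ a ih =>
    obtain ⟨m, rfl⟩ := exists_eq_add_single (by omega : m k ≠ 0)
    rw [monomial_eq_smul_X_mul_pderiv k l, map_smul, ← lie_X_smul_pderiv_ham hkl]
    refine B.smul_mem _ (hstable k l hkl _ (ih _ ?_ ?_))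
    · simp at hm ⊢
      omega
    · simp at ha
      simp [ha, hkl]

theorem lie_mem_M {i j : ℕ} {D E : W K n} (hD : D ∈ M K n i) (hE : E ∈ M K n j) :
    ⁅D, E⁆ ∈ M K n (i + j) := by
  refine mem_M.2 ⟨lie_mem_comp_nat hD.1 hE.1, ?_⟩
  rw [divergence_lie, (mem_M.1 hD).2, (mem_M.1 hE).2]
  simp

theorem brackets_M_M [CharZero K] [NeZero n] (i j : ℕ) :
    brackets (M K n i) (M K n j) = M K n (i + j) := by
  apply le_antisymm
  · exact brackets_le.2 fun D hD E hE => lie_mem_M hD hE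
  · refine M_le fun k l hkl m hm => ?_
    obtain ⟨u, v, rfl, hu, hv⟩ := exists_add_of_degree_eq (a := i + 1) (b := j + 1) (m := m)
      (by omega)
    have hu' : (monomial u (1 : K)).IsHomogeneous (i + 1) := isHomogeneous_monomial _ hu
    have hv' : (monomial v (1 : K)).IsHomogeneous (j + 1) := isHomogeneous_monomial _ hv
    have hk : ((u k : K) + v k) + (u l + v l) + 2 ≠ 0 := by
      exact_mod_cast (show u k + v k + (u l + v l) + 2 ≠ 0 by omega)
    -- A single bracket may have coefficient zero, for instance `(1 + u_l)(1 + v_k) - u_k v_l` in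
    -- the first one. In this difference the quadratic terms in the exponents cancel and a positive
    -- integer remains.
    have key : ⁅ham k l (monomial u (1 : K) * X l), ham k l (monomial v 1 * X k)⁆ -
        ⁅ham k l (monomial u (1 : K) * X k), ham k l (monomial v 1 * X l)⁆ =
        (((u k : K) + v k) + (u l + v l) + 2) • ham k l (monomial (u + v) (1 : K)) := by
      rw [lie_ham, lie_ham, ← map_sub, ← map_smul]
      congr 1
      have e : ∀ a : Fin n, X a * pderiv a (monomial (u + v) (1 : K)) =
          ((u a : K) + v a) • monomial (u + v) (1 : K) := by
        intro a
        rw [X_mul_pderiv_monomial]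
        simp [← Nat.cast_smul_eq_nsmul K]
      rw [add_smul, add_smul, ← e k, ← e l, ← mul_one (1 : K), ← monomial_mul]
      simp only [ham_apply, Derivation.leibniz, smul_eq_mul, pderiv_X_self, pderiv_X_of_ne hkl,
        pderiv_X_of_ne hkl.symm, smul_eq_C_mul, map_ofNat, mul_one]
      ring
    rw [← inv_smul_smul₀ hk (ham k l _), ← key]
    refine Submodule.smul_mem _ _ (sub_mem ?_ ?_) <;>
    exact lie_mem_brackets (ham_mem_M _ _ (hu'.mul (isHomogeneous_X _ _)))
      (ham_mem_M _ _ (hv'.mul (isHomogeneous_X _ _)))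

end Hamiltonian

/-! ### Brackets involving multiples of the Euler field -/

section Mixed

variable {K : Type*} [Field K] {n : ℕ}

theorem lie_smul_euler {i : ℕ} {D : W K n} (hD : D ∈ comp K n i) (f : MvPolynomial (Fin n) K) :
    ⁅D, f • euler K n⁆ = D f • euler K n - (i : K) • f • D := by
  rw [lie_smul_right, lie_euler_of_mem_comp hD, smul_neg, smul_comm, sub_eq_add_neg]

theorem smul_euler_mem_N [NeZero n] {i : ℕ} {f : MvPolynomial (Fin n) K}
    (hf : f.IsHomogeneous i) : f • euler K n ∈ N K n i :=
  mem_N.2 ⟨f, hf, rfl⟩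

theorem smul_pderiv_mem_M {i : ℕ} {f : MvPolynomial (Fin n) K} (hf : f.IsHomogeneous (i + 1))
    {k : Fin n} (hk : pderiv k f = 0) : f • (pderiv k : W K n) ∈ M K n i := by
  refine mem_M.2 ⟨smul_pderiv_mem_comp hf k, ?_⟩
  rw [divergence_smul, hk, divergence_pderiv, mul_zero, add_zero]

theorem X_smul_pderiv_mem_M {k l : Fin n} (hkl : k ≠ l) :
    (X k : MvPolynomial (Fin n) K) • (pderiv l : W K n) ∈ M K n 0 :=
  smul_pderiv_mem_M (isHomogeneous_X K k) (pderiv_X_of_ne hkl)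

theorem lie_comp_zero_smul_euler {D : W K n} (hD : D ∈ comp K n (0 : ℕ))
    (f : MvPolynomial (Fin n) K) : ⁅D, f • euler K n⁆ = D f • euler K n := by
  rw [lie_smul_euler hD, Nat.cast_zero, zero_smul, sub_zero]

theorem lie_mem_N_of_mem_comp_zero [NeZero n] {D : W K n} (hD : D ∈ comp K n (0 : ℕ)) {j : ℕ}
    {E : W K n} (hE : E ∈ N K n j) : ⁅D, E⁆ ∈ N K n j := by
  obtain ⟨f, hf, rfl⟩ := mem_N.1 hE
  rw [lie_comp_zero_smul_euler hD]
  have := isHomogeneous_apply hD hf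
  rw [zero_add] at this
  exact smul_euler_mem_N this

theorem N_le [NeZero n] {i : ℕ} {B : Submodule K (W K n)}
    (hB : ∀ m : Fin n →₀ ℕ, m.degree = i → monomial m (1 : K) • euler K n ∈ B) : N K n i ≤ B := by
  intro D hD
  obtain ⟨f, hf, rfl⟩ := mem_N.1 hD
  exact homogeneousSubmodule_le
    (T := B.comap ((LinearMap.toSpanSingleton (MvPolynomial (Fin n) K) _
      (euler K n)).restrictScalars K)) hB hf

/-- A subspace stable under all `x_k ∂/∂x_l` with `k ≠ l` contains `N_i` as soon as it contains
`x_l ^ i E_n` for some `l`. -/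
theorem N_le_of_stable [CharZero K] [NeZero n] {i : ℕ} {B : Submodule K (W K n)}
    (hstable : ∀ k l : Fin n, k ≠ l → ∀ D ∈ B,
      ⁅(X k : MvPolynomial (Fin n) K) • (pderiv l : W K n), D⁆ ∈ B)
    (l : Fin n) (hB : (X l : MvPolynomial (Fin n) K) ^ i • euler K n ∈ B) : N K n i ≤ B := by
  -- Starting from `x_l ^ i`, factors `x_l` are converted one at a time into the variables of `x^r`;
  -- `b` counts the conversions, and `r` may itself involve `x_l`.
  suffices h : ∀ (b a : ℕ) (r : Fin n →₀ ℕ), r.degree = b → a + b = i →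
      monomial (r + Finsupp.single l a) (1 : K) • euler K n ∈ B by
    refine N_le fun m hm => ?_
    simpa using h i 0 m hm (zero_add i)
  intro b
  induction b with
  | zero =>
    intro a r hr hi
    obtain rfl : r = 0 := (Finsupp.degree_eq_zero_iff r).1 hr
    rwa [zero_add, ← X_pow_eq_monomial, show a = i from hi]
  | succ b ih =>
    intro a r hr hi
    have hr0 : r ≠ 0 := by
      rintro rfl
      simp at hr
    obtain ⟨k, hk⟩ := Finsupp.ne_iff.1 hr0
    obtain ⟨r, rfl⟩ := exists_eq_add_single hk
    have hr' : r.degree = b := by simpa using hr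
    have hmem := ih (a + 1) r hr' (by omega)
    rw [Finsupp.single_add, ← add_assoc] at hmem
    rw [add_right_comm]
    by_cases hkl : k = l
    · rwa [hkl]
    · rw [monomial_eq_smul_X_mul_pderiv k l, smul_assoc]
      refine B.smul_mem _ ?_
      have := hstable k l hkl _ hmem
      rwa [lie_comp_zero_smul_euler (X_smul_pderiv_mem_M hkl).1] at this

theorem brackets_N_N [CharZero K] [NeZero n] {i j : ℕ} (hij : i ≠ j) :
    brackets (N K n i) (N K n j) = N K n (i + j) := by
  apply le_antisymm
  · rw [brackets_le]
    intro D hD E hE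
    obtain ⟨f, hf, rfl⟩ := mem_N.1 hD
    obtain ⟨g, hg, rfl⟩ := mem_N.1 hE
    rw [lie_smul_smul_euler hf hg]
    exact Submodule.smul_mem _ _ (smul_euler_mem_N (hf.mul hg))
  · refine N_le fun m hm => ?_
    obtain ⟨u, v, rfl, hu, hv⟩ := exists_add_of_degree_eq hm
    have hu' : (monomial u (1 : K)).IsHomogeneous i := isHomogeneous_monomial _ hu
    have hv' : (monomial v (1 : K)).IsHomogeneous j := isHomogeneous_monomial _ hv
    have hne : (j : K) - i ≠ 0 := sub_ne_zero.2 (Nat.cast_injective.ne hij.symm)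
    rw [← inv_smul_smul₀ hne (_ • _), ← mul_one (1 : K), ← monomial_mul,
      ← lie_smul_smul_euler hu' hv']
    exact Submodule.smul_mem _ _ (lie_mem_brackets (smul_euler_mem_N hu') (smul_euler_mem_N hv'))

theorem brackets_N_self [NeZero n] (i : ℕ) : brackets (N K n i) (N K n i) = ⊥ := by
  rw [eq_bot_iff, brackets_le]
  intro D hD E hE
  obtain ⟨f, hf, rfl⟩ := mem_N.1 hD
  obtain ⟨g, hg, rfl⟩ := mem_N.1 hE
  rw [lie_smul_smul_euler hf hg]
  simp

theorem mem_N_zero [NeZero n] {D : W K n} : D ∈ N K n 0 ↔ ∃ c : K, D = c • euler K n := by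
  rw [mem_N]
  constructor
  · rintro ⟨f, hf, rfl⟩
    rw [← totalDegree_zero_iff_isHomogeneous, totalDegree_eq_zero_iff_eq_C] at hf
    refine ⟨coeff 0 f, ?_⟩
    rw [hf, ← algebraMap_eq, algebraMap_smul]
    simp
  · rintro ⟨c, rfl⟩
    exact ⟨C c, isHomogeneous_C _ _, by rw [← algebraMap_eq, algebraMap_smul]⟩

theorem lie_const_smul (c : K) (D E : W K n) : ⁅D, c • E⁆ = c • ⁅D, E⁆ :=
  LieAlgebra.lie_smul c D E

theorem brackets_M_zero_N_zero [NeZero n] : brackets (M K n 0) (N K n 0) = ⊥ := by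
  rw [eq_bot_iff, brackets_le]
  intro D hD E hE
  obtain ⟨c, rfl⟩ := mem_N_zero.1 hE
  rw [lie_const_smul, lie_euler_of_mem_comp hD.1]
  simp

theorem brackets_M_N_zero [CharZero K] [NeZero n] {i : ℕ} (hi : 1 ≤ i) :
    brackets (M K n i) (N K n 0) = M K n i := by
  apply le_antisymm
  · rw [brackets_le]
    intro D hD E hE
    obtain ⟨c, rfl⟩ := mem_N_zero.1 hE
    rw [lie_const_smul, lie_euler_of_mem_comp hD.1]
    exact Submodule.smul_mem _ _ (neg_mem (Submodule.smul_mem _ _ hD))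
  · intro D hD
    have hne : (i : K) ≠ 0 := Nat.cast_ne_zero.2 (by omega)
    rw [← inv_smul_smul₀ hne D, ← neg_neg ((i : K) • D), ← lie_euler_of_mem_comp hD.1]
    exact Submodule.smul_mem _ _ (neg_mem (lie_mem_brackets hD (mem_N_zero.2 ⟨1, by simp⟩)))

/-- A field in `M_i` and a polynomial of degree `j + 1` whose pairing is a pure power: the seed for
`N_le_of_stable`. -/
theorem lie_X_pow_smul_pderiv_apply {k l : Fin n} (hkl : k ≠ l) (i j : ℕ) :
    ((X l : MvPolynomial (Fin n) K) ^ (i + 1) • (pderiv k : W K n)) (X k * X l ^ j) =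
      X l ^ (i + (j + 1)) := by
  simp only [Derivation.smul_apply, Derivation.leibniz, pderiv_X_self, Derivation.leibniz_pow,
    pderiv_X_of_ne hkl.symm, smul_eq_mul]
  ring

theorem pderiv_X_pow_of_ne {k l : Fin n} (hkl : k ≠ l) (i : ℕ) :
    pderiv k ((X l : MvPolynomial (Fin n) K) ^ i) = 0 := by
  simp [Derivation.leibniz_pow, pderiv_X_of_ne hkl.symm]

theorem X_pow_smul_pderiv_mem_M {k l : Fin n} (hkl : k ≠ l) (i : ℕ) :
    (X l : MvPolynomial (Fin n) K) ^ (i + 1) • (pderiv k : W K n) ∈ M K n i :=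
  smul_pderiv_mem_M (isHomogeneous_X_pow l _) (pderiv_X_pow_of_ne hkl _)

theorem X_mul_X_pow_smul_euler_mem_N [NeZero n] (k l : Fin n) (j : ℕ) :
    ((X k : MvPolynomial (Fin n) K) * X l ^ j) • euler K n ∈ N K n (j + 1) := by
  rw [add_comm]
  exact smul_euler_mem_N ((isHomogeneous_X K k).mul (isHomogeneous_X_pow l j))

theorem lie_mem_brackets_M_N [NeZero n] (i j : ℕ) (k l : Fin n) (hkl : k ≠ l) (D : W K n)
    (hD : D ∈ brackets (M K n i) (N K n j)) :
    ⁅(X k : MvPolynomial (Fin n) K) • (pderiv l : W K n), D⁆ ∈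
      brackets (M K n i) (N K n j) := by
  refine lie_mem_brackets_of_stable (fun E hE => ?_)
    (fun E hE => lie_mem_N_of_mem_comp_zero (X_smul_pderiv_mem_M hkl).1 hE) hD
  have := lie_mem_M (X_smul_pderiv_mem_M hkl) hE
  rwa [zero_add] at this

theorem brackets_M_zero_N [CharZero K] (hn : 2 ≤ n) {j : ℕ} (hj : 1 ≤ j) :
    brackets (M K n 0) (N K n j) = N K n j := by
  have : NeZero n := ⟨by omega⟩
  have : Nontrivial (Fin n) := Fin.nontrivial_iff_two_le.2 hn
  obtain ⟨k, l, hkl⟩ := exists_pair_ne (Fin n)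
  apply le_antisymm
  · exact brackets_le.2 fun D hD E hE => lie_mem_N_of_mem_comp_zero hD.1 hE
  · refine N_le_of_stable (lie_mem_brackets_M_N 0 j) l ?_
    obtain ⟨j, rfl⟩ := Nat.exists_eq_add_of_le' hj
    rw [← zero_add (j + 1), ← lie_X_pow_smul_pderiv_apply hkl,
      ← lie_comp_zero_smul_euler (X_pow_smul_pderiv_mem_M hkl 0).1, zero_add (j + 1)]
    exact lie_mem_brackets (X_pow_smul_pderiv_mem_M hkl 0) (X_mul_X_pow_smul_euler_mem_N k l j)

/-- The component of `D` in `N_i` is `(n + i)⁻¹ (div D) E`, which has the same divergence as `D`. -/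
theorem comp_eq_sup [CharZero K] [NeZero n] (i : ℕ) : comp K n i = M K n i ⊔ N K n i := by
  refine le_antisymm (fun D hD => ?_) (sup_le inf_le_left inf_le_left)
  have hne : (n : K) + i ≠ 0 := by
    exact_mod_cast (show n + i ≠ 0 from fun h => NeZero.ne n (by omega))
  have hE := smul_euler_mem_N (isHomogeneous_divergence hD)
  rw [← sub_add_cancel D (((n : K) + i)⁻¹ • divergence K n D • euler K n)]
  refine Submodule.add_mem_sup (mem_M.2 ⟨sub_mem hD (Submodule.smul_mem _ _ hE.1), ?_⟩)
    (Submodule.smul_mem _ _ hE)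
  rw [map_sub, map_smul, divergence_smul_euler (isHomogeneous_divergence hD),
    inv_smul_smul₀ hne, sub_self]

theorem M_inf_N [CharZero K] [NeZero n] (i : ℕ) : M K n i ⊓ N K n i = ⊥ := by
  rw [eq_bot_iff]
  rintro D ⟨hM, hN⟩
  obtain ⟨f, hf, rfl⟩ := mem_N.1 hN
  have hne : (n : K) + i ≠ 0 := by
    exact_mod_cast (show n + i ≠ 0 from fun h => NeZero.ne n (by omega))
  have := (mem_M.1 hM).2
  rw [divergence_smul_euler hf, smul_eq_zero_iff_right hne] at this
  simp [this]

theorem brackets_M_N [CharZero K] (hn : 2 ≤ n) {i j : ℕ} (hi : 1 ≤ i) (hj : 1 ≤ j) :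
    brackets (M K n i) (N K n j) = comp K n (i + j : ℕ) := by
  have : NeZero n := ⟨by omega⟩
  have : Nontrivial (Fin n) := Fin.nontrivial_iff_two_le.2 hn
  obtain ⟨k, l, hkl⟩ := exists_pair_ne (Fin n)
  apply le_antisymm
  · exact brackets_le.2 fun D hD E hE => lie_mem_comp_nat hD.1 hE.1
  have hM : M K n (i + j) ≤ brackets (M K n i) (N K n j) := by
    refine M_le_of_stable (lie_mem_brackets_M_N i j) fun k m hmk hm => ?_
    -- Since `x^v` is free of `x_k`, the field `x^u ∂/∂x_k` kills it, and the bracket with `x^v E`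
    -- is `-i x^(u+v) ∂/∂x_k`. This is where `i ≥ 1` matters.
    obtain ⟨u, v, rfl, hu, hv⟩ := exists_add_of_degree_eq (a := i + 1) (b := j) (m := m)
      (by omega)
    obtain ⟨huk, hvk⟩ : u k = 0 ∧ v k = 0 := by simpa using hmk
    have hD : monomial u (1 : K) • (pderiv k : W K n) ∈ M K n i :=
      smul_pderiv_mem_M (isHomogeneous_monomial _ hu) (by simp [pderiv_monomial, huk])
    have hb := lie_mem_brackets hD (smul_euler_mem_N (isHomogeneous_monomial (1 : K) hv))
    rw [lie_smul_euler hD.1, Derivation.smul_apply, pderiv_monomial, hvk, Nat.cast_zero, mul_zero,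
      monomial_zero, smul_zero, zero_smul, zero_sub, neg_mem_iff,
      Submodule.smul_mem_iff _ (Nat.cast_ne_zero.2 (by omega)), smul_smul, monomial_mul, one_mul,
      add_comm v] at hb
    exact hb
  rw [comp_eq_sup]
  refine sup_le hM (N_le_of_stable (lie_mem_brackets_M_N i j) l ?_)
  obtain ⟨j, rfl⟩ := Nat.exists_eq_add_of_le' hj
  set D := (X l : MvPolynomial (Fin n) K) ^ (i + 1) • (pderiv k : W K n) with hDdef
  have hD : D ∈ M K n i := X_pow_smul_pderiv_mem_M hkl i
  set f := (X k : MvPolynomial (Fin n) K) * X l ^ j with hf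
  have hfhom : f.IsHomogeneous (j + 1) := by
    rw [add_comm]
    exact (isHomogeneous_X K k).mul (isHomogeneous_X_pow l j)
  have hb := lie_mem_brackets hD (smul_euler_mem_N hfhom)
  have hDf : D f = X l ^ (i + (j + 1)) := lie_X_pow_smul_pderiv_apply hkl i j
  have hsum : (n : K) + (i + (j + 1) : ℕ) ≠ 0 := by
    exact_mod_cast (show n + (i + (j + 1)) ≠ 0 by omega)
  have hnj : (n : K) + (j + 1 : ℕ) ≠ 0 := by
    exact_mod_cast (show n + (j + 1) ≠ 0 by omega)
  have hEhom : ((X l : MvPolynomial (Fin n) K) ^ (i + (j + 1))).IsHomogeneous (i + (j + 1)) :=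
    isHomogeneous_X_pow l _
  -- The two scalars are chosen to cancel divergences: the bracket has divergence `(n + j + 1) D f`,
  -- and `(D f) E` has `(n + i + j + 1) D f`. The difference lies in `M`, already known to be
  -- contained in the brackets, so `(D f) E` is too.
  have hmem : ((n : K) + (i + (j + 1) : ℕ)) • ⁅D, f • euler K n⁆ -
      ((n : K) + (j + 1 : ℕ)) • (X l : MvPolynomial (Fin n) K) ^ (i + (j + 1)) • euler K n ∈
        M K n (i + (j + 1)) := by
    refine mem_M.2 ⟨sub_mem (Submodule.smul_mem _ _
      (lie_mem_comp_nat hD.1 (smul_euler_mem_N hfhom).1))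
      (Submodule.smul_mem _ _ (smul_euler_mem_N hEhom).1), ?_⟩
    rw [map_sub, map_smul, map_smul, divergence_smul_euler hEhom, divergence_lie, (mem_M.1 hD).2,
      divergence_smul_euler hfhom, map_zero, sub_zero, Derivation.map_smul, hDf, smul_comm,
      sub_self]
  have := sub_mem (Submodule.smul_mem _ ((n : K) + (i + (j + 1) : ℕ)) hb) (hM hmem)
  rw [sub_sub_cancel, Submodule.smul_mem_iff _ hnj] at this
  exact this

theorem pderiv_mem_comp (k : Fin n) : (pderiv k : W K n) ∈ comp K n (-1) := by
  have : (pderiv k : W K n) ∈ comp K n (((0 : ℕ) : ℤ) - 1) := by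
    rw [mem_comp_natCast_sub_one]
    intro j
    rw [pderiv_X]
    by_cases h : j = k
    · subst h
      simpa using isHomogeneous_one _ _
    · simpa [Pi.single_apply, h] using isHomogeneous_zero _ _ _
  simpa using this

theorem lie_pderiv_smul_euler (k : Fin n) (f : MvPolynomial (Fin n) K) :
    ⁅(pderiv k : W K n), f • euler K n⁆ = pderiv k f • euler K n + f • pderiv k := by
  rw [lie_smul_right]
  congr 2
  apply derivation_ext
  intro j
  rw [Derivation.commutator_apply, euler_X, pderiv_X]
  by_cases h : j = k
  · subst h
    simp
  · simp [h]

theorem brackets_comp_neg_one_N [CharZero K] [NeZero n] (j : ℕ) :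
    brackets (comp K n (-1)) (N K n j) = comp K n ((j : ℤ) - 1) := by
  apply le_antisymm
  · rw [brackets_le]
    intro D hD E hE
    have := lie_mem_comp hD hE.1
    rwa [neg_add_eq_sub] at this
  have hmem : ∀ (k : Fin n) (f : MvPolynomial (Fin n) K), f.IsHomogeneous j →
      ⁅(pderiv k : W K n), f • euler K n⁆ ∈ brackets (comp K n (-1)) (N K n j) :=
    fun k f hf => lie_mem_brackets (pderiv_mem_comp k) (smul_euler_mem_N hf)
  -- Each bracket `[∂/∂x_k, f E]` is `(∂f/∂x_k) E + f ∂/∂x_k`; once the first summand is known to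
  -- lie in the span, the second does as well.
  have hE : ∀ (k : Fin n) (f : MvPolynomial (Fin n) K), f.IsHomogeneous j →
      pderiv k f • euler K n ∈ brackets (comp K n (-1)) (N K n j) := by
    intro k f hf
    obtain _ | j := j
    · rw [← totalDegree_zero_iff_isHomogeneous, totalDegree_eq_zero_iff_eq_C] at hf
      rw [hf, pderiv_C, zero_smul]
      exact zero_mem _
    · have hg : (pderiv k f).IsHomogeneous j := hf.pderiv
      generalize pderiv k f = g at hg
      have hsum := sum_mem fun (k : Fin n) (_ : k ∈ Finset.univ) => hmem k (X k * g) (by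
        rw [add_comm]
        exact (isHomogeneous_X K k).mul hg)
      have hne : (n : K) + j + 1 ≠ 0 := by exact_mod_cast (Nat.succ_ne_zero (n + j))
      -- The terms `∂(x_k g)/∂x_k` sum to `(n + j) g` by Euler's identity, and the terms `x_k g
      -- ∂/∂x_k` contribute one more `g E`.
      have e : ∑ k, ⁅(pderiv k : W K n), (X k * g) • euler K n⁆ =
          ((n : K) + j + 1) • g • euler K n := by
        simp only [lie_pderiv_smul_euler, Finset.sum_add_distrib, ← Finset.sum_smul]
        simp only [Derivation.leibniz, smul_eq_mul, Finset.sum_add_distrib, hg.sum_X_mul_pderiv,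
          pderiv_X_self, mul_comm (X _) g, mul_smul, ← Finset.smul_sum]
        rw [← euler, ← add_smul, ← smul_assoc]
        congr 1
        simp only [nsmul_eq_mul, Finset.sum_const, Finset.card_univ,
          Fintype.card_fin, smul_eq_C_mul, map_add, map_natCast, map_one]
        ring
      rwa [e, Submodule.smul_mem_iff _ hne] at hsum
  intro D hD
  rw [eq_sum_smul_pderiv D]
  refine sum_mem fun k _ => ?_
  have hk := mem_comp_natCast_sub_one.1 hD k
  have := sub_mem (hmem k _ hk) (hE k _ hk)
  rwa [lie_pderiv_smul_euler, add_sub_cancel_left] at this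

theorem exists_lieSubmodule_brackets (S T : LieSubmodule K (linearPart K n) (W K n)) :
    ∃ U : LieSubmodule K (linearPart K n) (W K n),
      U.toSubmodule = brackets S.toSubmodule T.toSubmodule :=
  ⟨{ brackets S.toSubmodule T.toSubmodule with
      lie_mem := fun {A _} hD => lie_mem_brackets_of_stable
        (A := (A : W K n)) (fun _ hE => S.lie_mem hE) (fun _ hE => T.lie_mem hE) hD }, rfl⟩

end Mixed

/-! ### Dimensions -/

section Dimension

variable {K : Type*} [Field K] {n : ℕ}

theorem finite_homogeneousSubmodule (d : ℕ) :
    Module.Finite K (homogeneousSubmodule (Fin n) K d) :=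
  Module.Finite.iff_fg.2 (homogeneousSubmodule_fg (Fin n) K d)

theorem finrank_homogeneousSubmodule (d : ℕ) :
    Module.finrank K (homogeneousSubmodule (Fin n) K d) = (n + d - 1).choose d := by
  have hs : {m : Fin n →₀ ℕ | m.degree = d} =
      ((Finset.univ.finsuppAntidiag d : Finset (Fin n →₀ ℕ)) : Set (Fin n →₀ ℕ)) := by
    ext m
    simp [Finset.mem_finsuppAntidiag, Finsupp.degree_eq_sum]
  rw [homogeneousSubmodule_eq_finsupp_supported, hs,
    (AddMonoidAlgebra.supportedEquivFinsupp _).finrank_eq, Module.finrank_finsupp_self]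
  simp [Finset.card_finsuppAntidiag_nat_eq_choose]

/-- A derivation of degree `d - 1` is the same as a family of `n` homogeneous polynomials of
degree `d`. -/
noncomputable def compEquiv (K : Type*) [Field K] (n d : ℕ) :
    comp K n ((d : ℤ) - 1) ≃ₗ[K] (Fin n → homogeneousSubmodule (Fin n) K d) where
  toFun D k := ⟨(D : W K n) (X k), mem_comp_natCast_sub_one.1 D.2 k⟩
  map_add' _ _ := rfl
  map_smul' _ _ := rfl
  invFun f := ⟨mkDerivation K fun k => (f k : MvPolynomial (Fin n) K),
    mem_comp_natCast_sub_one.2 fun j => by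
      rw [mkDerivation_X]
      exact (f j).2⟩
  left_inv D := Subtype.ext (derivation_ext fun k => mkDerivation_X _ _ k)
  right_inv f := funext fun k => Subtype.ext (mkDerivation_X _ _ k)

theorem finite_comp_natCast_sub_one (d : ℕ) : Module.Finite K (comp K n ((d : ℤ) - 1)) := by
  have := finite_homogeneousSubmodule (K := K) (n := n) d
  exact Module.Finite.equiv (compEquiv K n d).symm

theorem finrank_comp_natCast_sub_one (d : ℕ) :
    Module.finrank K (comp K n ((d : ℤ) - 1)) = n * (n + d - 1).choose d := by
  have := finite_homogeneousSubmodule (K := K) (n := n) d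
  rw [(compEquiv K n d).finrank_eq, Module.finrank_pi_fintype]
  simp [finrank_homogeneousSubmodule]

theorem finite_comp_natCast (i : ℕ) : Module.Finite K (comp K n i) := by
  have := finite_comp_natCast_sub_one (K := K) (n := n) (i + 1)
  rwa [Nat.cast_add_one, add_sub_cancel_right] at this

theorem finrank_comp_natCast (i : ℕ) :
    Module.finrank K (comp K n i) = n * (n + i).choose (i + 1) := by
  have := finrank_comp_natCast_sub_one (K := K) (n := n) (i + 1)
  rwa [Nat.cast_add_one, add_sub_cancel_right] at this

theorem finite_comp_and_finrank_comp (i : ℤ) (hi : -1 ≤ i) :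
    Module.Finite K (comp K n i) ∧
      Module.finrank K (comp K n i) = n * Nat.choose (n + i).toNat (i + 1).toNat := by
  -- Indexing by the coefficient degree `d = i + 1` makes `i = -1` the ordinary case `d = 0`.
  obtain ⟨d, hd⟩ := Int.eq_ofNat_of_zero_le (show 0 ≤ i + 1 by omega)
  obtain rfl : i = (d : ℤ) - 1 := by omega
  refine ⟨finite_comp_natCast_sub_one d, ?_⟩
  rw [finrank_comp_natCast_sub_one, show ((n : ℤ) + ((d : ℤ) - 1)).toNat = n + d - 1 by omega,
    show ((d : ℤ) - 1 + 1).toNat = d by omega]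

/-- The map `f ↦ f E_n`. -/
noncomputable def smulEuler (K : Type*) [Field K] (n : ℕ) : MvPolynomial (Fin n) K →ₗ[K] W K n :=
  (LinearMap.toSpanSingleton (MvPolynomial (Fin n) K) _ (euler K n)).restrictScalars K

theorem smulEuler_apply (f : MvPolynomial (Fin n) K) : smulEuler K n f = f • euler K n := rfl

theorem smulEuler_injective [NeZero n] : Function.Injective (smulEuler K n) := by
  rw [← LinearMap.ker_eq_bot, LinearMap.ker_eq_bot']
  intro f hf
  have := congrArg (fun D : W K n => D (X 0)) hf
  simpa [smulEuler_apply] using this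

theorem N_eq_map [NeZero n] (i : ℕ) :
    N K n i = (homogeneousSubmodule (Fin n) K i).map (smulEuler K n) := by
  ext D
  rw [mem_N, Submodule.mem_map]
  exact exists_congr fun f => and_congr Iff.rfl eq_comm

theorem finite_N [NeZero n] (i : ℕ) : Module.Finite K (N K n i) := by
  have := finite_homogeneousSubmodule (K := K) (n := n) i
  rw [N_eq_map]
  infer_instance

theorem finrank_N [NeZero n] (i : ℕ) : Module.finrank K (N K n i) = (n + i - 1).choose i := by
  rw [N_eq_map, ← (Submodule.equivMapOfInjective _ smulEuler_injective _).finrank_eq,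
    finrank_homogeneousSubmodule]

theorem finite_M (i : ℕ) : Module.Finite K (M K n i) :=
  have := finite_comp_natCast (K := K) (n := n) i
  Submodule.finiteDimensional_of_le inf_le_left

theorem finrank_M_add [CharZero K] [NeZero n] (i : ℕ) :
    Module.finrank K (M K n i) + (n + i - 1).choose i = n * (n + i).choose (i + 1) := by
  have := finite_M (K := K) (n := n) i
  have := finite_N (K := K) (n := n) i
  have h := Submodule.finrank_sup_add_finrank_inf_eq (M K n i) (N K n i)
  rw [← comp_eq_sup, M_inf_N, finrank_bot, add_zero, finrank_comp_natCast, finrank_N] at h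
  exact h.symm

theorem finrank_M [CharZero K] (hn : 2 ≤ n) (i : ℕ) :
    (Module.finrank K (M K n i) : ℚ) =
      ((n + i + 1 : ℕ) * Nat.factorial (n + i - 1)) /
        (Nat.factorial (i + 1) * Nat.factorial (n - 2)) := by
  have : NeZero n := ⟨by omega⟩
  have h := finrank_M_add (K := K) (n := n) i
  obtain ⟨k, rfl⟩ := Nat.exists_eq_add_of_le' hn
  generalize Module.finrank K (M K (k + 2) i) = r at h
  have e1 : (k + 2 + i).choose (i + 1) * Nat.factorial (i + 1) * Nat.factorial (k + 1) =
      Nat.factorial (k + 2 + i) := by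
    have := Nat.choose_mul_factorial_mul_factorial (show i + 1 ≤ k + 2 + i by omega)
    rwa [show k + 2 + i - (i + 1) = k + 1 by omega] at this
  have e2 : (k + 1 + i).choose i * Nat.factorial i * Nat.factorial (k + 1) =
      Nat.factorial (k + 1 + i) := by
    have := Nat.choose_mul_factorial_mul_factorial (show i ≤ k + 1 + i by omega)
    rwa [show k + 1 + i - i = k + 1 by omega] at this
  rw [show k + 2 + i - 1 = k + 1 + i by omega] at h ⊢
  rw [show k + 2 - 2 = k by omega]
  rw [show k + 2 + i = (k + 1 + i) + 1 by omega, Nat.factorial_succ (k + 1 + i),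
    Nat.factorial_succ i, Nat.factorial_succ k] at e1
  rw [Nat.factorial_succ k] at e2
  rw [Nat.factorial_succ i]
  rw [show k + 2 + i = (k + 1 + i) + 1 by omega] at h ⊢
  have p1 : (Nat.factorial i : ℚ) ≠ 0 := Nat.cast_ne_zero.2 (Nat.factorial_ne_zero i)
  have p2 : (Nat.factorial k : ℚ) ≠ 0 := Nat.cast_ne_zero.2 (Nat.factorial_ne_zero k)
  have p3 : (i : ℚ) + 1 ≠ 0 := Nat.cast_add_one_ne_zero i
  have p4 : (k : ℚ) + 1 ≠ 0 := Nat.cast_add_one_ne_zero k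
  have h' := congrArg (Nat.cast : ℕ → ℚ) h
  have e1' := congrArg (Nat.cast : ℕ → ℚ) e1
  have e2' := congrArg (Nat.cast : ℕ → ℚ) e2
  push_cast at h' e1' e2' ⊢
  rw [eq_div_iff (by positivity)]
  apply mul_right_cancel₀ p4
  -- Here `n = k + 2`. The dimension count `h'` is multiplied by `(i + 1)! (k + 1)!`; then `e1'` and
  -- `e2'` replace both binomials by factorials.
  linear_combination ((i : ℚ) + 1) * Nat.factorial i * Nat.factorial k * (k + 1) * h' +
    ((k : ℚ) + 2) * e1' - ((i : ℚ) + 1) * e2'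

end Dimension

end PolyVF

theorem mainTheorem4 (K : Type*) [Field K] [IsAlgClosed K] [CharZero K] (n : ℕ) (hn : 2 ≤ n) :
    -- dimensions
    (∀ i : ℤ, -1 ≤ i → Module.Finite K (PolyVF.comp K n i) ∧
      Module.finrank K (PolyVF.comp K n i) = n * Nat.choose (n + i).toNat (i + 1).toNat) ∧
    (∀ i : ℕ, Module.Finite K (PolyVF.N K n i) ∧
      Module.finrank K (PolyVF.N K n i) = Nat.choose (n + i - 1) i) ∧
    (∀ i : ℕ, Module.Finite K (PolyVF.M K n i) ∧
      (Module.finrank K (PolyVF.M K n i) : ℚ) =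
        ((n + i + 1 : ℕ) * Nat.factorial (n + i - 1)) /
          (Nat.factorial (i + 1) * Nat.factorial (n - 2))) ∧
    -- brackets of submodules over the degree zero component are submodules
    (∀ S T : LieSubmodule K (PolyVF.linearPart K n) (PolyVF.W K n),
      ∃ U : LieSubmodule K (PolyVF.linearPart K n) (PolyVF.W K n),
        U.toSubmodule = PolyVF.brackets S.toSubmodule T.toSubmodule) ∧
    (∀ i j : ℕ, PolyVF.brackets (PolyVF.M K n i) (PolyVF.M K n j) = PolyVF.M K n (i + j)) ∧
    (∀ i j : ℕ, i ≠ j →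
      PolyVF.brackets (PolyVF.N K n i) (PolyVF.N K n j) = PolyVF.N K n (i + j)) ∧
    (∀ i : ℕ, PolyVF.brackets (PolyVF.N K n i) (PolyVF.N K n i) = ⊥) ∧
    -- the mixed brackets, generic case first
    (∀ i j : ℕ, 1 ≤ i → 1 ≤ j →
      PolyVF.brackets (PolyVF.M K n i) (PolyVF.N K n j) = PolyVF.comp K n ((i : ℤ) + j)) ∧
    PolyVF.brackets (PolyVF.M K n 0) (PolyVF.N K n 0) = ⊥ ∧
    (∀ j : ℕ, 1 ≤ j →
      PolyVF.brackets (PolyVF.M K n 0) (PolyVF.N K n j) = PolyVF.N K n j) ∧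
    (∀ i : ℕ, 1 ≤ i →
      PolyVF.brackets (PolyVF.M K n i) (PolyVF.N K n 0) = PolyVF.M K n i) ∧
    (∀ j : ℕ, PolyVF.brackets (PolyVF.comp K n (-1)) (PolyVF.N K n j) =
      PolyVF.comp K n ((j : ℤ) - 1)) := by
  have : NeZero n := ⟨by omega⟩
  exact ⟨PolyVF.finite_comp_and_finrank_comp,
    fun i => ⟨PolyVF.finite_N i, PolyVF.finrank_N i⟩,
    fun i => ⟨PolyVF.finite_M i, PolyVF.finrank_M hn i⟩,
    PolyVF.exists_lieSubmodule_brackets,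
    PolyVF.brackets_M_M,
    fun _ _ hij => PolyVF.brackets_N_N hij,
    PolyVF.brackets_N_self,
    fun i j hi hj => by rw [PolyVF.brackets_M_N hn hi hj, Nat.cast_add],
    PolyVF.brackets_M_zero_N_zero,
    fun _ hj => PolyVF.brackets_M_zero_N hn hj,
    fun _ hi => PolyVF.brackets_M_N_zero hi,
    PolyVF.brackets_comp_neg_one_N⟩
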